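/- Let $\alpha>0$ and $x>0$ be real numbers and let $y\in C^4[0,x]$ be a real-valued function, with one-sided derivatives at the endpoints $0$ and $x$. For a positive integer $n$ put $h=x/n$, let $$K^\alpha y(x)=\int_0^x \frac{y(t)}{(x-t)^{1-\alpha}}\,dt ,$$ and let $\zeta$ be the (analytically continued) Riemann zeta function. Then, as $n\to\infty$ (that is, $h\to 0$) with $\alpha$, $x$ and $y$ fixed, $$\begin{aligned} h^{\alpha}\sum_{k=1}^{n-1} \frac{y(x-kh)}{k^{1-\alpha}}+\frac{y(0)}{2x^{1-\alpha}}h={}&K^{\alpha}y(x)+\frac{(\alpha-1) x^{\alpha-2}y(0)-x^{\alpha-1} y'(0)}{12}h^2+\zeta(1-\alpha)\, y(x)h^{\alpha}\\ &-\zeta(-\alpha)\,y'(x)h^{1+\alpha}+\zeta(-1-\alpha)\frac{y''(x)}{2}h^{2+\alpha}-\zeta(-2-\alpha)\frac{y'''(x)}{6}h^{3+\alpha}+O(h^4). \end{aligned}$$ Equivalently, there is a constant $C$, depending only on $\alpha$, $x$ and $y$, such that for every $n\ge 1$ the two sides without the $O$-term differ by at most $Ch^4$ in absolute value. -/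

import Mathlib

open Set MeasureTheory

/-- The Riemann zeta function at a real argument, as a real number. For `s ≤ 1` this is Mathlib's
analytic continuation; `zetaReal_coe` shows that no imaginary part is lost. -/
noncomputable def zetaReal (s : ℝ) : ℝ := (riemannZeta (s : ℂ)).re

theorem zetaReal_coe (s : ℝ) : ((zetaReal s : ℝ) : ℂ) = riemannZeta (s : ℂ) := by
  have h := riemannZeta_conj (s : ℂ)
  rw [Complex.conj_ofReal] at h
  exact Complex.conj_eq_iff_re.mp h.symm

/-- The fractional integral `K^α y(x) = ∫₀ˣ y(t) / (x - t)^(1-α) dt`. -/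
noncomputable def fracIntK (α : ℝ) (y : ℝ → ℝ) (x : ℝ) : ℝ :=
  ∫ t in (0 : ℝ)..x, y t / (x - t) ^ (1 - α)

/-- For `α > 0` and continuous `y` the integral `fracIntK α y x` converges. -/
theorem fracIntK_integrable {α x : ℝ} (hα : 0 < α) (hx : 0 < x) {y : ℝ → ℝ}
    (hy : ContinuousOn y (Icc 0 x)) :
    IntervalIntegrable (fun t => y t / (x - t) ^ (1 - α)) volume 0 x := by
  have h1 : IntervalIntegrable (fun t : ℝ => t ^ (α - 1)) volume x 0 :=
    intervalIntegral.intervalIntegrable_rpow' (by linarith)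
  have h2 : IntervalIntegrable (fun t : ℝ => (x - t) ^ (α - 1)) volume 0 x := by
    simpa using h1.comp_sub_left x
  have h3 := h2.continuousOn_mul (g := y) (by rwa [uIcc_of_le hx.le])
  refine h3.congr ?_
  intro t ht
  rw [uIoc_of_le hx.le] at ht
  have : (0 : ℝ) ≤ x - t := by linarith [ht.2]
  show y t * (x - t) ^ (α - 1) = y t / (x - t) ^ (1 - α)
  rw [div_eq_mul_inv, ← Real.rpow_neg this]
  congr 2
  ring

/-!
Write `f s = s ^ (α - 1) * y (x - s)`, so that the left-hand side is the trapezoidal sum of `f` on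
`[0, x]` with step `h`, the node at the singular end `0` omitted, and `fracIntK α y x = ∫₀ˣ f`.
Call *defect* of a function the difference between this sum and its integral plus the usual
end-point correction `h ^ 2 / 12 * f' x`; the defect is linear in the function. Taylor expansion of
`y` at `x` gives `f s = ∑_{j < 4} d j * s ^ (α - 1 + j) + s ^ (α - 1) * R s` with `R s = O(s ^ 4)`,
and the two kinds of terms are treated separately. Both rest on a corrected trapezoidal rule
with error `h ^ 4 / 384 * ∫ ‖f⁗‖` (`DerivChain.norm_composite_trapezoid_le`), obtained by summing
a Peano-kernel identity over the cells; it involves only first derivatives at the two ends.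

* A power `s ^ b` with `b > -1` has defect `ζ (-b) h ^ (b + 1) + O(h ^ 4)`
  (`exists_trapezoid_rpow_le`). By homogeneity this is the statement that
  `∑_{k ≤ n} k ^ b` (last term halved) minus `n ^ (b + 1) / (b + 1) + b n ^ (b - 1) / 12` is
  `ζ (-b) + O(n ^ (b - 3))`. For `b < 3` the trapezoidal rule on the cells `[k, k + 1]` shows that
  this quantity converges, at that rate and locally uniformly in complex `b`. The limit is therefore
  analytic, and it is `ζ (-b)` for `re b < -1`, hence on `re b < 3` by the identity theorem
  (`tendsto_powerSumDefect`). For `b ≥ 3` the constant is absorbed in the error term.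
* The remainder `s ^ (α - 1) * R s` has defect `O(h ^ 4)` (`exists_trapezoid_remainder_le`),
  since its fourth derivative is `O(s ^ (α - 1))`, an integrable function, and it is so small
  on the first cell that no correction arises there.
-/

open Filter Topology

/-! ### The corrected trapezoidal rule -/

/-- `f 0, …, f m` are continuous on `[a, b]`, and each `f (i + 1)` is the derivative of `f i` in
the open interval. Nothing is required of one-sided derivatives at the end points. -/
structure DerivChain {E : Type*} [NormedAddCommGroup E] [NormedSpace ℝ E]
    (m : ℕ) (a b : ℝ) (f : ℕ → ℝ → E) : Prop where
  cont : ∀ i ≤ m, ContinuousOn (f i) (Icc a b)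
  deriv : ∀ i < m, ∀ t ∈ Ioo a b, HasDerivAt (f i) (f (i + 1) t) t

section Trapezoid

variable {E : Type*} [NormedAddCommGroup E] [NormedSpace ℝ E]

theorem DerivChain.mono {m : ℕ} {a b c d : ℝ} {f : ℕ → ℝ → E} (hf : DerivChain m a b f)
    (hc : a ≤ c) (hd : d ≤ b) : DerivChain m c d f where
  cont i hi := (hf.cont i hi).mono (Icc_subset_Icc hc hd)
  deriv i hi t ht := hf.deriv i hi t (Ioo_subset_Ioo hc hd ht)

theorem DerivChain.intervalIntegrable {m : ℕ} {a b : ℝ} {f : ℕ → ℝ → E}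
    (hf : DerivChain m a b f) {i : ℕ} (hi : i ≤ m) {c d : ℝ} (hc : c ∈ Icc a b)
    (hd : d ∈ Icc a b) : IntervalIntegrable (f i) volume c d :=
  ((hf.cont i hi).mono (uIcc_subset_Icc hc hd)).intervalIntegrable

variable [CompleteSpace E]

/-- The error of the trapezoidal rule with end-point correction on a single cell, in Peano form.
The kernel `(t - a)² (b - t)² / 24` vanishes doubly at both ends, its second derivative takes the
value `(b - a)² / 12` there, and its fourth derivative is `1`. -/
theorem DerivChain.corrected_trapezoid_eq {a b : ℝ} (hab : a ≤ b) {f : ℕ → ℝ → E}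
    (hf : DerivChain 4 a b f) :
    ((b - a) / 2) • (f 0 a + f 0 b) - (∫ t in a..b, f 0 t) - ((b - a) ^ 2 / 12) • (f 1 b - f 1 a)
      = -∫ t in a..b, ((t - a) ^ 2 * (b - t) ^ 2 / 24) • f 4 t := by
  have ha : a ∈ Icc a b := left_mem_Icc.2 hab
  have hb : b ∈ Icc a b := right_mem_Icc.2 hab
  have hint0 := hf.intervalIntegrable (i := 0) (by norm_num) ha hb
  have hint4 : IntervalIntegrable (fun t => ((t - a) ^ 2 * (b - t) ^ 2 / 24) • f 4 t) volume a b :=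
    (hf.intervalIntegrable le_rfl ha hb).continuousOn_smul (by fun_prop)
  have key := intervalIntegral.integral_eq_sub_of_hasDerivAt_of_le hab
    (f := fun t => ((t - a) ^ 2 * (b - t) ^ 2 / 24) • f 3 t
      - ((t - a) * (b - t) * (a + b - 2 * t) / 12) • f 2 t
      + (((b - t) ^ 2 - 4 * (t - a) * (b - t) + (t - a) ^ 2) / 12) • f 1 t
      - (t - (a + b) / 2) • f 0 t)
    (f' := fun t => ((t - a) ^ 2 * (b - t) ^ 2 / 24) • f 4 t - f 0 t) ?_ ?_ (hint4.sub hint0)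
  · rw [intervalIntegral.integral_sub hint4 hint0] at key
    rw [sub_eq_iff_eq_add.1 key]
    module
  · have h0 := hf.cont 0 (by norm_num)
    have h1 := hf.cont 1 (by norm_num)
    have h2 := hf.cont 2 (by norm_num)
    have h3 := hf.cont 3 (by norm_num)
    fun_prop
  · intro t ht
    have d0 := hf.deriv 0 (by norm_num) t ht
    have d1 := hf.deriv 1 (by norm_num) t ht
    have d2 := hf.deriv 2 (by norm_num) t ht
    have d3 := hf.deriv 3 (by norm_num) t ht
    have hl : HasDerivAt (fun t : ℝ => t - a) 1 t := (hasDerivAt_id t).sub_const a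
    have hr : HasDerivAt (fun t : ℝ => b - t) (-1) t := (hasDerivAt_id t).const_sub b
    have hm : HasDerivAt (fun t : ℝ => a + b - 2 * t) (-(2 * 1)) t :=
      ((hasDerivAt_id t).const_mul 2).const_sub (a + b)
    have p3 := ((hl.pow 2).mul (hr.pow 2)).div_const 24
    have p2 := ((hl.mul hr).mul hm).div_const 12
    have p1 := ((((hr.pow 2).sub ((hl.const_mul 4).mul hr))).add (hl.pow 2)).div_const 12
    have p0 := (hasDerivAt_id t).sub_const ((a + b) / 2)
    convert! (((p3.smul d3).sub (p2.smul d2)).add (p1.smul d1)).sub (p0.smul d0) using 1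
    simp only [Pi.mul_apply, Pi.pow_apply, id_eq, Nat.cast_ofNat]
    norm_num
    module

theorem DerivChain.norm_corrected_trapezoid_le {a b : ℝ} (hab : a ≤ b) {f : ℕ → ℝ → E}
    (hf : DerivChain 4 a b f) :
    ‖((b - a) / 2) • (f 0 a + f 0 b) - (∫ t in a..b, f 0 t)
        - ((b - a) ^ 2 / 12) • (f 1 b - f 1 a)‖
      ≤ (b - a) ^ 4 / 384 * ∫ t in a..b, ‖f 4 t‖ := by
  rw [hf.corrected_trapezoid_eq hab, norm_neg, ← intervalIntegral.integral_const_mul]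
  refine intervalIntegral.norm_integral_le_of_norm_le hab (ae_of_all _ fun t ht => ?_)
    ((hf.intervalIntegrable le_rfl (left_mem_Icc.2 hab) (right_mem_Icc.2 hab)).norm.const_mul _)
  rw [norm_smul, Real.norm_of_nonneg (by positivity)]
  refine mul_le_mul_of_nonneg_right ?_ (norm_nonneg _)
  have h1 : 0 ≤ (t - a) * (b - t) := mul_nonneg (by linarith [ht.1]) (by linarith [ht.2])
  have h2 : (t - a) * (b - t) ≤ (b - a) ^ 2 / 4 := by nlinarith [sq_nonneg ((t - a) - (b - t))]
  have h3 := pow_le_pow_left₀ h1 h2 2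
  nlinarith [h3]

/-- The corrected trapezoidal rule with nodes `k h`, `m ≤ k ≤ n`: the corrections at interior
nodes cancel, so only the first derivatives at the two ends enter. -/
theorem DerivChain.norm_composite_trapezoid_le {h : ℝ} (hh : 0 ≤ h) {m n : ℕ} (hmn : m ≤ n)
    {f : ℕ → ℝ → E} (hf : DerivChain 4 (m * h) (n * h) f) :
    ‖h • ∑ k ∈ Finset.Ico m n, f 0 (k * h) + (h / 2) • (f 0 (n * h) - f 0 (m * h))
        - (∫ t in (m * h)..(n * h), f 0 t) - (h ^ 2 / 12) • (f 1 (n * h) - f 1 (m * h))‖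
      ≤ h ^ 4 / 384 * ∫ t in (m * h)..(n * h), ‖f 4 t‖ := by
  induction n, hmn using Nat.le_induction with
  | base => simp
  | succ n hmn ih =>
    have hmn' : (m : ℝ) * h ≤ n * h := by gcongr
    have hn : (n : ℝ) * h ≤ (n + 1 : ℕ) * h := by gcongr; simp
    have hl := hf.mono le_rfl hn
    have hr := hf.mono hmn' le_rfl
    have hc := hr.norm_corrected_trapezoid_le hn
    have hstep : ((n + 1 : ℕ) : ℝ) * h - n * h = h := by push_cast; ring
    rw [hstep] at hc
    have ma : (m : ℝ) * h ∈ Icc ((m : ℝ) * h) ((n + 1 : ℕ) * h) := ⟨le_rfl, hmn'.trans hn⟩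
    have mb : (n : ℝ) * h ∈ Icc ((m : ℝ) * h) ((n + 1 : ℕ) * h) := ⟨hmn', hn⟩
    have mc : ((n + 1 : ℕ) : ℝ) * h ∈ Icc ((m : ℝ) * h) ((n + 1 : ℕ) * h) :=
      ⟨hmn'.trans hn, le_rfl⟩
    rw [← intervalIntegral.integral_add_adjacent_intervals
        (hf.intervalIntegrable le_rfl ma mb).norm (hf.intervalIntegrable le_rfl mb mc).norm,
      ← intervalIntegral.integral_add_adjacent_intervals
        (hf.intervalIntegrable (Nat.zero_le 4) ma mb) (hf.intervalIntegrable (Nat.zero_le 4) mb mc),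
      Finset.sum_Ico_succ_top hmn, mul_add]
    refine le_trans (le_of_eq ?_) ((norm_add_le _ _).trans (add_le_add (ih hl) hc))
    congr 1
    module

end Trapezoid

/-! ### Sums of powers and the zeta function -/


theorem derivChain_ofReal_cpow (β : ℂ) (m : ℕ) {a b : ℝ} (ha : 0 < a) :
    DerivChain m a b fun i t => (∏ j ∈ Finset.range i, (β - j)) * (t : ℂ) ^ (β - i) where
  cont i _ := by
    refine continuousOn_const.mul fun t ht => ContinuousAt.continuousWithinAt ?_
    exact Complex.continuousAt_ofReal_cpow_const t _ (Or.inr (ha.trans_le ht.1).ne')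
  deriv i _ t ht := by
    have ht0 : t ≠ 0 := (ha.trans ht.1).ne'
    rw [Finset.prod_range_succ, mul_assoc]
    refine HasDerivAt.const_mul _ ?_
    by_cases h0 : β - i = 0
    · simpa [h0] using hasDerivAt_const t (1 : ℂ)
    · simpa [sub_sub] using hasDerivAt_ofReal_cpow_const ht0 h0

/-- The sum `∑_{1 ≤ k ≤ N} k ^ β`, with the last term halved, minus the two terms
`N ^ (β + 1) / (β + 1) + β N ^ (β - 1) / 12` of its Euler–Maclaurin expansion. -/
noncomputable def powerSumDefect (β : ℂ) (N : ℕ) : ℂ :=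
  ∑ k ∈ Finset.Ico 1 N, (k : ℂ) ^ β + (N : ℂ) ^ β / 2 - (N : ℂ) ^ (β + 1) / (β + 1)
    - β * (N : ℂ) ^ (β - 1) / 12

theorem norm_powerSumDefect_sub_le {β : ℂ} (hβ : β ≠ -1) {m n : ℕ} (hm : 1 ≤ m) (hmn : m ≤ n) :
    ‖powerSumDefect β n - powerSumDefect β m‖
      ≤ ‖∏ j ∈ Finset.range 4, (β - (j : ℂ))‖ / 384 * ∫ t in (m : ℝ)..n, t ^ (β.re - 4) := by
  have hm0 : (0 : ℝ) < m := by exact_mod_cast hm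
  have hmn' : (m : ℝ) ≤ n := by exact_mod_cast hmn
  have hmem : (0 : ℝ) ∉ uIcc (m : ℝ) n := by
    rw [uIcc_of_le hmn']; exact fun h => hm0.not_ge h.1
  have key := (derivChain_ofReal_cpow β 4 (a := m * 1) (b := n * 1)
    (by simpa using hm0)).norm_composite_trapezoid_le zero_le_one hmn
  simp only [mul_one, one_smul, Finset.range_zero, Finset.prod_empty, one_mul, Nat.cast_zero,
    sub_zero, Finset.range_one, Finset.prod_singleton, Nat.cast_one, one_pow,
    Complex.ofReal_natCast] at key
  rw [integral_cpow (Or.inr ⟨hβ, hmem⟩)] at key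
  refine le_trans (le_of_eq ?_) (key.trans (le_of_eq ?_))
  · congr 1
    unfold powerSumDefect
    rw [← Finset.sum_Ico_consecutive _ hm hmn]
    simp only [Complex.real_smul, Complex.ofReal_natCast]
    push_cast
    ring
  · rw [mul_comm (1 / 384 : ℝ), ← intervalIntegral.integral_const_mul,
      ← intervalIntegral.integral_mul_const]
    refine intervalIntegral.integral_congr fun t ht => ?_
    rw [uIcc_of_le hmn'] at ht
    have : 0 < t := hm0.trans_le ht.1
    simp only [norm_mul, Complex.norm_cpow_eq_rpow_re_of_pos this, Nat.cast_ofNat,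
      Complex.sub_re, Complex.re_ofNat]
    ring

theorem norm_powerSumDefect_succ_sub_le {β : ℂ} (hβ : β ≠ -1) {σ : ℝ} (hσ : β.re ≤ σ)
    (hσ' : σ ≤ 4) (n : ℕ) :
    ‖powerSumDefect β (n + 2) - powerSumDefect β (n + 1)‖
      ≤ ‖∏ j ∈ Finset.range 4, (β - (j : ℂ))‖ / 384 * ((n + 1 : ℕ) : ℝ) ^ (σ - 4) := by
  refine (norm_powerSumDefect_sub_le hβ (Nat.le_add_left 1 n) (Nat.le_succ (n + 1))).trans ?_
  gcongr
  have h1 : (1 : ℝ) ≤ (n + 1 : ℕ) := by simp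
  have hle : ((n + 1 : ℕ) : ℝ) ≤ (n + 1 + 1 : ℕ) := by gcongr; simp
  have := intervalIntegral.norm_integral_le_of_norm_le_const (a := ((n + 1 : ℕ) : ℝ))
    (b := (n + 1 + 1 : ℕ)) (f := fun t => t ^ (β.re - 4)) (C := ((n + 1 : ℕ) : ℝ) ^ (σ - 4)) ?_
  · refine (le_abs_self _).trans (this.trans (le_of_eq ?_))
    push_cast
    simp
  · intro t ht
    rw [uIoc_of_le hle] at ht
    have ht1 : 1 ≤ t := h1.trans ht.1.le
    rw [Real.norm_of_nonneg (by positivity)]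
    calc t ^ (β.re - 4) ≤ t ^ (σ - 4) := Real.rpow_le_rpow_of_exponent_le ht1 (by linarith)
      _ ≤ _ := Real.rpow_le_rpow_of_nonpos (by linarith) ht.1.le (by linarith)

theorem differentiableOn_powerSumDefect (N : ℕ) (hN : 1 ≤ N) {U : Set ℂ}
    (hU : ∀ β ∈ U, β ≠ -1) : DifferentiableOn ℂ (fun β => powerSumDefect β N) U := by
  have hpow : ∀ k : ℕ, 1 ≤ k → Differentiable ℂ fun β : ℂ => (k : ℂ) ^ β := fun k hk =>
    differentiable_id.const_cpow (Or.inl (by exact_mod_cast (by omega : k ≠ 0)))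
  have hN' := hpow N hN
  have h1 : Differentiable ℂ fun β : ℂ => ∑ k ∈ Finset.Ico 1 N, (k : ℂ) ^ β :=
    Differentiable.fun_sum fun k hk => hpow k (Finset.mem_Ico.1 hk).1
  have h2 : Differentiable ℂ fun β : ℂ => (N : ℂ) ^ (β + 1) :=
    hN'.comp (differentiable_id.add_const 1)
  have h3 : Differentiable ℂ fun β : ℂ => (N : ℂ) ^ (β - 1) :=
    hN'.comp (differentiable_id.sub_const 1)
  unfold powerSumDefect
  refine ((h1.differentiableOn.add (hN'.div_const 2).differentiableOn).sub
    (h2.differentiableOn.div (differentiable_id.add_const 1).differentiableOn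
      fun β hβ h => hU β hβ (eq_neg_of_add_eq_zero_left h))).sub
    ((differentiable_id.mul h3).div_const 12).differentiableOn

theorem tendsto_powerSumDefect_of_re_lt_neg_one {β : ℂ} (hβ : β.re < -1) :
    Tendsto (powerSumDefect β) atTop (𝓝 (riemannZeta (-β))) := by
  have hpow : ∀ γ : ℂ, γ.re < 0 → Tendsto (fun N : ℕ => (N : ℂ) ^ γ) atTop (𝓝 0) := by
    intro γ hγ
    rw [tendsto_zero_iff_norm_tendsto_zero]
    have := (tendsto_rpow_neg_atTop (neg_pos.2 hγ)).comp (tendsto_natCast_atTop_atTop (R := ℝ))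
    refine this.congr' ?_
    filter_upwards [eventually_gt_atTop 0] with N hN
    simp [Complex.norm_natCast_cpow_of_pos hN]
  have hre : 1 < (-β).re := by simpa using by linarith
  have hs : HasSum (fun n : ℕ => ((n + 1 : ℕ) : ℂ) ^ β) (riemannZeta (-β)) := by
    rw [zeta_eq_tsum_one_div_nat_add_one_cpow hre]
    have h := (summable_nat_add_iff 1).2 (Complex.summable_one_div_nat_cpow.2 hre)
    simp only [Complex.cpow_neg, one_div, inv_inv, Nat.cast_add, Nat.cast_one] at h ⊢
    exact h.hasSum
  have hsum : Tendsto (fun N : ℕ => ∑ k ∈ Finset.Ico 1 N, (k : ℂ) ^ β) atTop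
      (𝓝 (riemannZeta (-β))) := by
    rw [← tendsto_add_atTop_iff_nat 1]
    refine hs.tendsto_sum_nat.congr fun N => ?_
    rw [Finset.sum_Ico_eq_sum_range]
    simp [add_comm]
  have h0 := hpow β (by linarith)
  have h1 := hpow (β + 1) (by simpa using by linarith)
  have h2 := hpow (β - 1) (by simpa using by linarith)
  have := ((hsum.add (h0.div_const 2)).sub (h1.div_const (β + 1))).sub
    ((h2.const_mul β).div_const 12)
  unfold powerSumDefect
  simpa using this

/-- The limit of `powerSumDefect β` continues `ζ (-β)` analytically to `re β < 3`: the increments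
are `O(N ^ (re β - 4))` locally uniformly. The identity theorem is applied on a domain that
avoids the pole `β = -1`: the union of two convex sets, one in `re β > -1` and one in the upper half
plane, the latter reaching into `re β < -1`. -/
theorem tendsto_powerSumDefect {b : ℝ} (hb : -1 < b) (hb' : b < 3) :
    Tendsto (powerSumDefect b) atTop (𝓝 (riemannZeta (-b))) := by
  obtain ⟨σ, hσ, hσ3⟩ := exists_between (max_lt hb' (by norm_num : (0 : ℝ) < 3))
  obtain ⟨hbσ, hσ0⟩ := max_lt_iff.1 hσ
  set B : ℝ := |b| + 4 with hB
  have hBpos : 0 < B := by positivity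
  set D : Set ℂ := Metric.ball 0 B ∩ {z | z.re < σ} with hD
  set U : Set ℂ := D ∩ {z | -1 < z.re} ∪ D ∩ {z | 0 < z.im} with hU
  have hDconv : Convex ℝ D := (convex_ball 0 B).inter (convex_halfSpace_re_lt σ)
  have hDopen : IsOpen D :=
    Metric.isOpen_ball.inter (isOpen_lt Complex.continuous_re continuous_const)
  have hUopen : IsOpen U :=
    (hDopen.inter (isOpen_lt continuous_const Complex.continuous_re)).union
      (hDopen.inter (isOpen_lt continuous_const Complex.continuous_im))
  have hID : Complex.I ∈ D := by
    refine ⟨?_, by simpa using hσ0⟩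
    simp only [mem_ball_zero_iff, Complex.norm_I, hB]
    linarith [abs_nonneg b]
  have hUconn : IsPreconnected U :=
    IsPreconnected.union Complex.I ⟨hID, by simp⟩ ⟨hID, by simp⟩
      (hDconv.inter (convex_halfSpace_re_gt (-1))).isPreconnected
      (hDconv.inter (convex_halfSpace_im_gt 0)).isPreconnected
  have hUD : ∀ z ∈ U, z ∈ D := fun z hz => hz.elim And.left And.left
  have hUne : ∀ z ∈ U, z ≠ -1 := by
    rintro z (hz | hz) rfl <;> simpa using hz.2
  have hprod : ∀ z ∈ U, ‖∏ j ∈ Finset.range 4, (z - (j : ℂ))‖ ≤ (B + 3) ^ 4 := by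
    intro z hz
    rw [norm_prod]
    refine (Finset.prod_le_prod (fun _ _ => norm_nonneg _) (g := fun _ => B + 3)
      fun j hj => ?_).trans (by simp)
    have hzB : ‖z‖ < B := by simpa using (hUD z hz).1
    have hj' : (j : ℝ) ≤ 3 := by exact_mod_cast Nat.le_of_lt_succ (Finset.mem_range.1 hj)
    have := norm_sub_le z (j : ℂ)
    rw [Complex.norm_natCast] at this
    linarith
  have hu : Summable fun n : ℕ => (B + 3) ^ 4 / 384 * ((n + 1 : ℕ) : ℝ) ^ (σ - 4) :=
    ((summable_nat_add_iff 1).2 (Real.summable_nat_rpow.2 (by linarith))).mul_left _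
  have hle : ∀ (n : ℕ), ∀ z ∈ U, ‖powerSumDefect z (n + 2) - powerSumDefect z (n + 1)‖
      ≤ (B + 3) ^ 4 / 384 * ((n + 1 : ℕ) : ℝ) ^ (σ - 4) := by
    intro n z hz
    refine (norm_powerSumDefect_succ_sub_le (hUne z hz) (hUD z hz).2.le (by linarith) n).trans ?_
    gcongr
    exact hprod z hz
  set G : ℂ → ℂ := fun z =>
    powerSumDefect z 1 + ∑' n : ℕ, (powerSumDefect z (n + 2) - powerSumDefect z (n + 1)) with hG
  have hGdiff : DifferentiableOn ℂ G U :=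
    (differentiableOn_powerSumDefect 1 le_rfl hUne).add
      (Complex.differentiableOn_tsum_of_summable_norm hu
        (fun n => (differentiableOn_powerSumDefect _ (by omega) hUne).sub
          (differentiableOn_powerSumDefect _ (by omega) hUne)) hUopen hle)
  have hlim : ∀ z ∈ U, Tendsto (powerSumDefect z) atTop (𝓝 (G z)) := by
    intro z hz
    rw [← tendsto_add_atTop_iff_nat 1]
    refine ((Summable.of_norm_bounded hu (fun n => hle n z hz)).hasSum.tendsto_sum_nat.const_add
      (powerSumDefect z 1)).congr fun N => ?_
    rw [Finset.sum_range_sub (fun n => powerSumDefect z (n + 1))]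
    simp
  have hζ : DifferentiableOn ℂ (fun z => riemannZeta (-z)) U := fun z hz =>
    ((differentiableAt_riemannZeta (fun h => hUne z hz (neg_eq_iff_eq_neg.1 h))).comp z
      differentiable_neg.differentiableAt).differentiableWithinAt
  have hz₀ : (-2 + Complex.I) ∈ U := by
    refine Or.inr ⟨⟨?_, ?_⟩, by simp⟩
    · rw [mem_ball_zero_iff]
      refine (norm_add_le _ _).trans_lt ?_
      simp only [norm_neg, Complex.norm_ofNat, Complex.norm_I, hB]
      linarith [abs_nonneg b]
    · simp; linarith
  have hEq : EqOn G (fun z => riemannZeta (-z)) U := by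
    refine (hGdiff.analyticOnNhd hUopen).eqOn_of_preconnected_of_eventuallyEq
      (hζ.analyticOnNhd hUopen) hUconn hz₀ ?_
    have hnear : ∀ᶠ z : ℂ in 𝓝 (-2 + Complex.I), z.re < -1 :=
      (isOpen_lt Complex.continuous_re continuous_const).mem_nhds (by simp)
    filter_upwards [hnear, hUopen.mem_nhds hz₀] with z hz hzU
    exact tendsto_nhds_unique (hlim z hzU) (tendsto_powerSumDefect_of_re_lt_neg_one hz)
  have hbU : (b : ℂ) ∈ U := by
    refine Or.inl ⟨⟨?_, by simpa using hbσ⟩, by simpa using hb⟩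
    simp [hB]
  simpa [← hEq hbU] using hlim b hbU

theorem ofReal_powerSumDefect (b : ℝ) (n : ℕ) :
    powerSumDefect b n = ((∑ k ∈ Finset.Ico 1 n, (k : ℝ) ^ b + (n : ℝ) ^ b / 2
      - (n : ℝ) ^ (b + 1) / (b + 1) - b * (n : ℝ) ^ (b - 1) / 12 : ℝ) : ℂ) := by
  unfold powerSumDefect
  push_cast [Complex.ofReal_cpow (Nat.cast_nonneg _)]
  rfl

/-- Although the defect of a power sum tends to `ζ (-b)` only for `b < 3`, the estimate holds for
all `b > -1`. -/
theorem exists_norm_powerSumDefect_sub_zeta_le {b : ℝ} (hb : -1 < b) :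
    ∃ C : ℝ, ∀ n : ℕ, 1 ≤ n →
      ‖powerSumDefect b n - riemannZeta (-b)‖ ≤ C * (n : ℝ) ^ (b - 3) := by
  have hb1 : (b : ℂ) ≠ -1 := by exact_mod_cast hb.ne'
  obtain ⟨K, hK⟩ : ∃ K : ℝ, K = ‖∏ j ∈ Finset.range 4, ((b : ℂ) - (j : ℂ))‖ / 384 := ⟨_, rfl⟩
  have hK0 : 0 ≤ K := hK ▸ by positivity
  have hsub : ∀ m n : ℕ, 1 ≤ m → m ≤ n → b ≠ 3 → ‖powerSumDefect b n - powerSumDefect b m‖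
      ≤ K * (((n : ℝ) ^ (b - 3) - (m : ℝ) ^ (b - 3)) / (b - 3)) := by
    intro m n hm hmn h3
    refine (norm_powerSumDefect_sub_le hb1 hm hmn).trans (le_of_eq ?_)
    have hm0 : (0 : ℝ) < m := by exact_mod_cast hm
    have hmn' : (m : ℝ) ≤ n := by exact_mod_cast hmn
    have hmem : (0 : ℝ) ∉ uIcc (m : ℝ) n := by
      rw [uIcc_of_le hmn']; exact fun h => hm0.not_ge h.1
    rw [Complex.ofReal_re, integral_rpow (Or.inr ⟨fun h => h3 (by linarith), hmem⟩),
      show b - 4 + 1 = b - 3 by ring, hK]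
  rcases lt_or_ge b 3 with h3 | h3
  · refine ⟨K / (3 - b), fun n hn => ?_⟩
    have hlim : Tendsto (fun m => ‖powerSumDefect b n - powerSumDefect b m‖) atTop
        (𝓝 ‖powerSumDefect b n - riemannZeta (-b)‖) :=
      ((tendsto_powerSumDefect hb h3).const_sub _).norm
    refine le_of_tendsto hlim ?_
    filter_upwards [eventually_ge_atTop n] with m hm
    rw [norm_sub_rev]
    refine (hsub n m hn hm h3.ne).trans ?_
    rw [← neg_div_neg_eq, neg_sub, neg_sub, ← mul_div_right_comm, mul_div_assoc]
    have : 0 < 3 - b := by linarith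
    gcongr
    linarith [Real.rpow_nonneg (Nat.cast_nonneg (α := ℝ) m) (b - 3)]
  -- For `b ≥ 3` the right-hand side does not tend to zero, so the constant is irrelevant and
  -- only the growth of the defect matters.
  · refine ⟨K / (b - 3) + ‖powerSumDefect b 1 - riemannZeta (-b)‖, fun n hn => ?_⟩
    have hn1 : 1 ≤ (n : ℝ) ^ (b - 3) :=
      Real.one_le_rpow (by exact_mod_cast hn) (by linarith)
    have hdiff : ‖powerSumDefect b n - powerSumDefect b 1‖ ≤ K / (b - 3) * (n : ℝ) ^ (b - 3) := by
      rcases h3.eq_or_lt with rfl | h3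
      -- The fourth derivative of `t ^ 3` vanishes, so no logarithm arises at `b = 3`.
      · refine (norm_powerSumDefect_sub_le hb1 le_rfl hn).trans (le_of_eq ?_)
        simp [Finset.prod_range_succ]
      · refine (hsub 1 n le_rfl hn h3.ne').trans ?_
        rw [← mul_div_right_comm, mul_div_assoc]
        have : 0 < b - 3 := by linarith
        gcongr
        simp
    calc _ ≤ ‖powerSumDefect b n - powerSumDefect b 1‖
          + ‖powerSumDefect b 1 - riemannZeta (-b)‖ := norm_sub_le_norm_sub_add_norm_sub _ _ _
      _ ≤ K / (b - 3) * (n : ℝ) ^ (b - 3)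
          + ‖powerSumDefect b 1 - riemannZeta (-b)‖ * (n : ℝ) ^ (b - 3) :=
        add_le_add hdiff (le_mul_of_one_le_right (norm_nonneg _) hn1)
      _ = _ := by ring

/-- The corrected trapezoidal rule for `∫₀ˣ s ^ b ds` without the node `0`: the singularity at `0`
contributes the term `ζ (-b) h ^ (b + 1)`, up to `O(h ^ 4)`. -/
theorem exists_trapezoid_rpow_le {b x : ℝ} (hb : -1 < b) (hx : 0 < x) :
    ∃ C : ℝ, ∀ (n : ℕ) (h : ℝ), 1 ≤ n → x = n * h →
      |h * ∑ k ∈ Finset.Ico 1 n, ((k : ℝ) * h) ^ b + h / 2 * x ^ b - x ^ (b + 1) / (b + 1)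
        - h ^ 2 / 12 * (b * x ^ (b - 1)) - zetaReal (-b) * h ^ (b + 1)| ≤ C * h ^ 4 := by
  obtain ⟨C, hC⟩ := exists_norm_powerSumDefect_sub_zeta_le hb
  refine ⟨C * x ^ (b - 3), fun n h hn hxh => ?_⟩
  have hn0 : (0 : ℝ) < n := by exact_mod_cast hn
  have hh : 0 < h := pos_of_mul_pos_right (hxh ▸ hx) hn0.le
  have hz : riemannZeta (-b) = (zetaReal (-b) : ℂ) := by rw [zetaReal_coe]; simp
  have key := hC n hn
  rw [ofReal_powerSumDefect, hz, ← Complex.ofReal_sub, Complex.norm_real, Real.norm_eq_abs] at key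
  have hbd : h ^ (b + 1) * (C * (n : ℝ) ^ (b - 3)) = C * x ^ (b - 3) * h ^ 4 := by
    rw [hxh, Real.mul_rpow hn0.le hh.le,
      show b + 1 = b - 3 + (4 : ℕ) by push_cast; ring, Real.rpow_add_natCast hh.ne']
    ring
  rw [← hbd]
  refine le_trans (le_of_eq ?_) (mul_le_mul_of_nonneg_left key (Real.rpow_nonneg hh.le (b + 1)))
  rw [← abs_of_nonneg (Real.rpow_nonneg hh.le (b + 1)), ← abs_mul,
    abs_of_nonneg (Real.rpow_nonneg hh.le (b + 1))]
  congr 1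
  have hsum : ∑ k ∈ Finset.Ico 1 n, ((k : ℝ) * h) ^ b
      = h ^ b * ∑ k ∈ Finset.Ico 1 n, (k : ℝ) ^ b := by
    rw [Finset.mul_sum]
    exact Finset.sum_congr rfl fun k _ => by
      rw [Real.mul_rpow (Nat.cast_nonneg k) hh.le, mul_comm]
  rw [hsum, hxh, Real.mul_rpow hn0.le hh.le, Real.mul_rpow hn0.le hh.le,
    Real.mul_rpow hn0.le hh.le, Real.rpow_add_one hh.ne', Real.rpow_sub_one hh.ne' b]
  field_simp

/-! ### Remainders vanishing to fourth order at the singularity -/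

theorem derivChain_rpow (β : ℝ) (m : ℕ) {a b : ℝ} (ha : 0 < a) :
    DerivChain m a b fun i t => (∏ j ∈ Finset.range i, (β - j)) * t ^ (β - i) where
  cont i _ := continuousOn_const.mul fun t ht =>
    (Real.continuousAt_rpow_const t _ (Or.inl (ha.trans_le ht.1).ne')).continuousWithinAt
  deriv i _ t ht := by
    rw [Finset.prod_range_succ, mul_assoc]
    refine HasDerivAt.const_mul _ ?_
    convert! Real.hasDerivAt_rpow_const (p := β - i) (Or.inl (ha.trans ht.1).ne') using 2
    push_cast
    ring_nf

/-- Leibniz' rule for the product of two chains of at most four derivatives. -/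
theorem DerivChain.mul {m : ℕ} (hm : m ≤ 4) {a b : ℝ} {f g : ℕ → ℝ → ℝ} (hf : DerivChain m a b f)
    (hg : DerivChain m a b g) :
    DerivChain m a b fun i t =>
      ∑ j ∈ Finset.range (i + 1), (i.choose j : ℝ) * (f (i - j) t * g j t) where
  cont i hi := continuousOn_finsetSum _ fun j hj => continuousOn_const.mul
    ((hf.cont _ (by omega)).mul (hg.cont j (by have := Finset.mem_range.1 hj; omega)))
  deriv i hi t ht := by
    have key := HasDerivAt.fun_sum (u := Finset.range (i + 1)) fun j hj =>
      ((hf.deriv (i - j) (by omega) t ht).mul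
        (hg.deriv j (by have := Finset.mem_range.1 hj; omega) t ht)).const_mul (i.choose j : ℝ)
    convert! key using 1
    have hi4 : i < 4 := by omega
    interval_cases i <;> simp [Finset.sum_range_succ, Nat.choose] <;> ring

/-- If `R` is a chain of four derivatives with `R i s = O(s ^ (4 - i))`, then all derivatives of
`s ^ a * R 0 s` are as small as if `R 0 s` were `s ^ 4`. -/
theorem exists_leibniz_rpow_bound (a : ℝ) {M x : ℝ} (hM : 0 ≤ M) {R : ℕ → ℝ → ℝ}
    (hR : ∀ i ≤ 4, ∀ s ∈ Icc 0 x, |R i s| ≤ M * s ^ (4 - i)) :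
    ∃ K : ℝ, 0 ≤ K ∧ ∀ i ≤ 4, ∀ s ∈ Ioc 0 x,
      |∑ j ∈ Finset.range (i + 1), (i.choose j : ℝ) *
        (((∏ l ∈ Finset.range (i - j), (a - l)) * s ^ (a - (i - j : ℕ))) * R j s)|
        ≤ K * s ^ (a + 4 - i) := by
  set k : ℕ → ℝ := fun i => ∑ j ∈ Finset.range (i + 1), (i.choose j : ℝ) *
    (|∏ l ∈ Finset.range (i - j), (a - l)| * M) with hk
  have hk0 : ∀ i, 0 ≤ k i := fun i => Finset.sum_nonneg fun j _ => by positivity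
  refine ⟨∑ i ∈ Finset.range 5, k i, Finset.sum_nonneg fun i _ => hk0 i, fun i hi s hs => ?_⟩
  have hs0 := hs.1
  have h1 : k i ≤ ∑ i ∈ Finset.range 5, k i :=
    Finset.single_le_sum (fun i _ => hk0 i) (Finset.mem_range.2 (by omega))
  refine le_trans ?_ (mul_le_mul_of_nonneg_right h1 (Real.rpow_nonneg hs0.le _))
  rw [hk, Finset.sum_mul]
  refine (Finset.abs_sum_le_sum_abs _ _).trans (Finset.sum_le_sum fun j hj => ?_)
  have hji : j ≤ i := Nat.le_of_lt_succ (Finset.mem_range.1 hj)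
  have hpow : s ^ (a - (i - j : ℕ)) * s ^ (4 - j) = s ^ (a + 4 - i) := by
    rw [← Real.rpow_add_natCast hs0.ne', Nat.cast_sub hji, Nat.cast_sub (hji.trans hi)]
    congr 1
    push_cast
    ring
  rw [abs_mul, abs_mul, abs_mul, Nat.abs_cast, abs_of_nonneg (Real.rpow_nonneg hs0.le _), ← hpow]
  have := hR j (hji.trans hi) s ⟨hs0.le, hs.2⟩
  calc _ ≤ (i.choose j : ℝ) * (|∏ l ∈ Finset.range (i - j), (a - l)| * s ^ (a - (i - j : ℕ))
        * (M * s ^ (4 - j))) := by gcongr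
    _ = _ := by ring

/-- For an integrand `s ^ (α - 1) * R 0 s` with `R 0 s = O(s ^ 4)` the singularity at `0` is
invisible up to `O(h ^ 4)`: on the first cell every term is `O(h ^ (α + 4))`, and on the others the
fourth derivative is `O(s ^ (α - 1))`, which is integrable. -/
theorem exists_trapezoid_remainder_le {α x M : ℝ} (hα : 0 < α) (hx : 0 < x) (hM : 0 ≤ M)
    {R : ℕ → ℝ → ℝ} (hRc : DerivChain 4 0 x R)
    (hR : ∀ i ≤ 4, ∀ s ∈ Icc 0 x, |R i s| ≤ M * s ^ (4 - i)) :
    ∃ C : ℝ, ∀ (n : ℕ) (h : ℝ), 1 ≤ n → x = n * h →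
      |h * ∑ k ∈ Finset.Ico 1 n, ((k : ℝ) * h) ^ (α - 1) * R 0 (k * h)
        + h / 2 * (x ^ (α - 1) * R 0 x) - (∫ s in (0 : ℝ)..x, s ^ (α - 1) * R 0 s)
        - h ^ 2 / 12 * ((α - 1) * x ^ (α - 2) * R 0 x + x ^ (α - 1) * R 1 x)| ≤ C * h ^ 4 := by
  obtain ⟨K, hK, hbd⟩ := exists_leibniz_rpow_bound (α - 1) hM hR
  set f : ℕ → ℝ → ℝ := fun i s => ∑ j ∈ Finset.range (i + 1), (i.choose j : ℝ) *
        (((∏ l ∈ Finset.range (i - j), (α - 1 - l)) * s ^ (α - 1 - (i - j : ℕ))) * R j s) with hf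
  have hf0 : ∀ s, s ^ (α - 1) * R 0 s = f 0 s := fun s => by simp [hf]
  have hf1 : (α - 1) * x ^ (α - 2) * R 0 x + x ^ (α - 1) * R 1 x = f 1 x := by
    simp [hf, Finset.sum_range_succ, sub_sub]
    norm_num
  simp only [hf0, hf1]
  have hint : IntervalIntegrable (f 0) volume 0 x := by
    have h1 : IntervalIntegrable (fun s : ℝ => s ^ (α - 1)) volume 0 x :=
      intervalIntegral.intervalIntegrable_rpow' (by linarith)
    have h2 := h1.mul_continuousOn (g := R 0) (by
      rw [uIcc_of_le hx.le]; exact hRc.cont 0 (by norm_num))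
    exact h2.congr fun s _ => hf0 s
  refine ⟨K * x ^ α * (1 / 2 + 1 + 1 / 12) + K * x ^ α / (384 * α), fun n h hn hxh => ?_⟩
  have hn0 : (0 : ℝ) < n := by exact_mod_cast hn
  have hn1 : (1 : ℝ) ≤ n := by exact_mod_cast hn
  have hh : 0 < h := pos_of_mul_pos_right (hxh ▸ hx) hn0.le
  have hhx : h ≤ x := hxh ▸ le_mul_of_one_le_left hh.le hn1
  have hhm : h ∈ Ioc 0 x := ⟨hh, hhx⟩
  have hchain : DerivChain 4 h x f :=
    (derivChain_rpow (α - 1) 4 hh).mul le_rfl (hRc.mono hh.le le_rfl)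
  have hcomp : ‖h • ∑ k ∈ Finset.Ico 1 n, f 0 (k * h) + (h / 2) • (f 0 x - f 0 h)
        - (∫ t in h..x, f 0 t) - (h ^ 2 / 12) • (f 1 x - f 1 h)‖
      ≤ h ^ 4 / 384 * ∫ t in h..x, ‖f 4 t‖ := by
    have := DerivChain.norm_composite_trapezoid_le hh.le hn (f := f)
      (by rw [Nat.cast_one, one_mul, ← hxh]; exact hchain)
    rwa [Nat.cast_one, one_mul, ← hxh] at this
  have hint4 : ∫ t in h..x, ‖f 4 t‖ ≤ K * (x ^ α / α) := by
    have hi : IntervalIntegrable (fun s : ℝ => K * s ^ (α - 1)) volume h x :=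
      (intervalIntegral.intervalIntegrable_rpow' (by linarith)).const_mul K
    calc ∫ t in h..x, ‖f 4 t‖ ≤ ∫ t in h..x, K * t ^ (α - 1) := by
          refine intervalIntegral.integral_mono_on hhx
            (hchain.intervalIntegrable le_rfl (left_mem_Icc.2 hhx) (right_mem_Icc.2 hhx)).norm hi
            fun t ht => ?_
          have := hbd 4 le_rfl t ⟨hh.trans_le ht.1, ht.2⟩
          rwa [show α - 1 + 4 - ((4 : ℕ) : ℝ) = α - 1 by push_cast; ring] at this
      _ = K * ((x ^ α - h ^ α) / α) := by
          rw [intervalIntegral.integral_const_mul, integral_rpow (Or.inl (by linarith)),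
            sub_add_cancel]
      _ ≤ K * (x ^ α / α) := by
          gcongr
          linarith [Real.rpow_nonneg hh.le α]
  have hpow : ∀ p : ℕ, h ^ p * h ^ (α + 4 - p) ≤ x ^ α * h ^ 4 := fun p => by
    rw [mul_comm, ← Real.rpow_add_natCast hh.ne', sub_add_cancel,
      show α + 4 = α + (4 : ℕ) by push_cast; ring, Real.rpow_add_natCast hh.ne']
    gcongr
  have e0 : h * |f 0 h| ≤ K * (x ^ α * h ^ 4) := by
    have h1 := hbd 0 (by norm_num) h hhm
    have h2 := hpow 1
    rw [show α - 1 + 4 - ((0 : ℕ) : ℝ) = α + 4 - (1 : ℕ) by push_cast; ring] at h1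
    calc h * |f 0 h| ≤ h * (K * h ^ (α + 4 - (1 : ℕ))) := by gcongr
      _ = K * (h ^ 1 * h ^ (α + 4 - (1 : ℕ))) := by ring
      _ ≤ _ := by gcongr
  have e1 : h ^ 2 * |f 1 h| ≤ K * (x ^ α * h ^ 4) := by
    have h1 := hbd 1 (by norm_num) h hhm
    have h2 := hpow 2
    rw [show α - 1 + 4 - ((1 : ℕ) : ℝ) = α + 4 - (2 : ℕ) by push_cast; ring] at h1
    calc h ^ 2 * |f 1 h| ≤ h ^ 2 * (K * h ^ (α + 4 - (2 : ℕ))) := by gcongr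
      _ = K * (h ^ 2 * h ^ (α + 4 - (2 : ℕ))) := by ring
      _ ≤ _ := by gcongr
  have e2 : |∫ s in (0 : ℝ)..h, f 0 s| ≤ K * (x ^ α * h ^ 4) := by
    have h3 := intervalIntegral.norm_integral_le_of_norm_le_const (a := 0) (b := h) (f := f 0)
      (C := K * h ^ (α + 4 - (1 : ℕ))) fun s hs => by
        rw [uIoc_of_le hh.le] at hs
        refine (hbd 0 (by norm_num) s ⟨hs.1, hs.2.trans hhx⟩).trans ?_
        rw [show α - 1 + 4 - ((0 : ℕ) : ℝ) = α + 4 - (1 : ℕ) by push_cast; ring]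
        have : 0 ≤ α + 4 - ((1 : ℕ) : ℝ) := by push_cast; linarith
        have := hs.1.le
        have := hs.2
        gcongr
    have h2 := hpow 1
    rw [sub_zero, abs_of_pos hh] at h3
    calc _ ≤ K * h ^ (α + 4 - (1 : ℕ)) * h := h3
      _ = K * (h ^ 1 * h ^ (α + 4 - (1 : ℕ))) := by ring
      _ ≤ _ := by gcongr
  have h0m : (0 : ℝ) ∈ uIcc 0 x := left_mem_uIcc
  have hhm' : h ∈ uIcc 0 x := by rw [uIcc_of_le hx.le]; exact ⟨hh.le, hhx⟩
  rw [← intervalIntegral.integral_add_adjacent_intervals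
    (hint.mono_set (uIcc_subset_uIcc h0m hhm'))
    (hint.mono_set (uIcc_subset_uIcc hhm' right_mem_uIcc))]
  have hc := hcomp.trans (mul_le_mul_of_nonneg_left hint4 (by positivity))
  simp only [smul_eq_mul, Real.norm_eq_abs] at hc
  have e0' : |h * f 0 h| ≤ K * (x ^ α * h ^ 4) := by rwa [abs_mul, abs_of_pos hh]
  have e1' : |h ^ 2 * f 1 h| ≤ K * (x ^ α * h ^ 4) := by
    rwa [abs_mul, abs_of_pos (pow_pos hh 2)]
  have hconst : h ^ 4 / 384 * (K * (x ^ α / α)) = K * x ^ α / (384 * α) * h ^ 4 := by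
    field_simp
  rw [hconst] at hc
  rw [abs_le] at hc e0' e1' e2 ⊢
  constructor <;> linarith [hc.1, hc.2, e0'.1, e0'.2, e1'.1, e1'.2, e2.1, e2.2]

/-! ### Taylor expansion at the singular end -/

theorem ContDiffOn.derivChain_iteratedDerivWithin {m : ℕ} {a b : ℝ} (hab : a < b) {y : ℝ → ℝ}
    (hy : ContDiffOn ℝ m y (Icc a b)) :
    DerivChain m a b fun i => iteratedDerivWithin i y (Icc a b) where
  cont i hi := hy.continuousOn_iteratedDerivWithin (by exact_mod_cast hi) (uniqueDiffOn_Icc hab)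
  deriv i hi t ht := by
    have hd := hy.differentiableOn_iteratedDerivWithin (m := i) (by exact_mod_cast hi)
      (uniqueDiffOn_Icc hab) t (Ioo_subset_Icc_self ht)
    have := hd.hasDerivWithinAt.hasDerivAt (Icc_mem_nhds ht.1 ht.2)
    rwa [← iteratedDerivWithin_succ] at this

theorem DerivChain.comp_const_sub {m : ℕ} {x : ℝ} {f : ℕ → ℝ → ℝ} (hf : DerivChain m 0 x f) :
    DerivChain m 0 x fun i s => (-1) ^ i * f i (x - s) where
  cont i hi := continuousOn_const.mul <| (hf.cont i hi).comp (by fun_prop) fun s hs =>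
    ⟨by linarith [hs.2], by linarith [hs.1]⟩
  deriv i hi t ht := by
    have := ((hf.deriv i hi (x - t) ⟨by linarith [ht.2], by linarith [ht.1]⟩).comp_const_sub
      x t).const_mul ((-1) ^ i)
    convert! this using 1
    ring

/-- Subtracting from each derivative the matching derivative of the Taylor polynomial at `0` of
degree `m - 1` of the first function. -/
theorem DerivChain.sub_taylor {m : ℕ} {x : ℝ} {g : ℕ → ℝ → ℝ} (hg : DerivChain m 0 x g) :
    DerivChain m 0 x fun i s =>
      g i s - ∑ l ∈ Finset.range (m - i), g (i + l) 0 * s ^ l / (l.factorial : ℝ) where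
  cont i hi := (hg.cont i hi).sub (by fun_prop)
  deriv i hi t ht := by
    refine (hg.deriv i hi t ht).sub ?_
    obtain ⟨d, rfl⟩ : ∃ d, m = i + 1 + d := ⟨m - (i + 1), by omega⟩
    rw [show i + 1 + d - i = d + 1 by omega, show i + 1 + d - (i + 1) = d by omega]
    have key := HasDerivAt.fun_sum (u := Finset.range (d + 1)) fun l _ =>
      ((hasDerivAt_pow l t).const_mul (g (i + l) 0)).div_const (l.factorial : ℝ)
    convert! key using 1
    rw [Finset.sum_range_succ']
    simp only [Nat.cast_zero, zero_mul, mul_zero, zero_div, add_zero]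
    refine Finset.sum_congr rfl fun l _ => ?_
    rw [Nat.factorial_succ, show i + 1 + l = i + (l + 1) by ring, Nat.add_sub_cancel]
    have : (l.factorial : ℝ) ≠ 0 := by positivity
    push_cast
    field_simp

/-- Iterated mean value inequality: the bound on the last function of the chain propagates down,
gaining a factor `s` at each step because the earlier functions vanish at `0`. -/
theorem DerivChain.abs_le_pow {m : ℕ} {x M : ℝ} {R : ℕ → ℝ → ℝ} (hR : DerivChain m 0 x R)
    (h0 : ∀ i < m, R i 0 = 0) (hM : ∀ s ∈ Icc 0 x, |R m s| ≤ M) :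
    ∀ i ≤ m, ∀ s ∈ Icc 0 x, |R i s| ≤ M * s ^ (m - i) := by
  intro i hi
  induction hi using Nat.decreasingInduction with
  | self => simpa using hM
  | of_succ i hi ih =>
    intro s hs
    have hM0 : 0 ≤ M := (abs_nonneg _).trans (hM s hs)
    rcases hs.1.eq_or_lt with rfl | hs0
    · rw [h0 i hi, abs_zero]
      positivity
    obtain ⟨c, hc, hc'⟩ := exists_hasDerivAt_eq_slope (R i) (R (i + 1)) hs0
      ((hR.cont i hi.le).mono (Icc_subset_Icc le_rfl hs.2))
      fun t ht => hR.deriv i hi t ⟨ht.1, ht.2.trans_le hs.2⟩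
    rw [h0 i hi, sub_zero, sub_zero, eq_div_iff hs0.ne'] at hc'
    rw [← hc', abs_mul, abs_of_pos hs0, show m - i = m - (i + 1) + 1 by omega, pow_succ,
      ← mul_assoc]
    refine mul_le_mul_of_nonneg_right ((ih c ⟨hc.1.le, hc.2.le.trans hs.2⟩).trans ?_) hs0.le
    have := hc.1.le
    have := hc.2.le
    gcongr

theorem fracIntK_eq_integral_rpow_mul {α x : ℝ} (hx : 0 < x) (y : ℝ → ℝ) :
    fracIntK α y x = ∫ s in (0 : ℝ)..x, s ^ (α - 1) * y (x - s) := by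
  have := intervalIntegral.integral_comp_sub_left (a := 0) (b := x)
    (fun s => s ^ (α - 1) * y (x - s)) x
  rw [sub_self, sub_zero] at this
  rw [← this]
  refine intervalIntegral.integral_congr fun t ht => ?_
  rw [uIcc_of_le hx.le] at ht
  have h0 : 0 ≤ x - t := sub_nonneg.2 ht.2
  simp only [sub_sub_cancel]
  rw [div_eq_mul_inv, ← Real.rpow_neg h0, neg_sub, mul_comm]

/-! ### The asymptotic expansion -/

theorem corollary3 (α x : ℝ) (hα : 0 < α) (hx : 0 < x) (y : ℝ → ℝ)
    (hy : ContDiffOn ℝ 4 y (Set.Icc 0 x)) :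
    ∃ C : ℝ, ∀ (n : ℕ) (h : ℝ), 1 ≤ n → x = n * h →
      |(h ^ α * ∑ k ∈ Finset.Icc 1 (n - 1), y (x - k * h) / (k : ℝ) ^ (1 - α)
          + y 0 / (2 * x ^ (1 - α)) * h)
        - (fracIntK α y x
          + ((α - 1) * x ^ (α - 2) * y 0
              - x ^ (α - 1) * iteratedDerivWithin 1 y (Set.Icc 0 x) 0) / 12 * h ^ 2
          + zetaReal (1 - α) * y x * h ^ α
          - zetaReal (-α) * iteratedDerivWithin 1 y (Set.Icc 0 x) x * h ^ (1 + α)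
          + zetaReal (-1 - α) * (iteratedDerivWithin 2 y (Set.Icc 0 x) x / 2) * h ^ (2 + α)
          - zetaReal (-2 - α) * (iteratedDerivWithin 3 y (Set.Icc 0 x) x / 6) * h ^ (3 + α))|
        ≤ C * h ^ 4 := by
  set Y : ℕ → ℝ → ℝ := fun i => iteratedDerivWithin i y (Icc 0 x) with hY
  have hYc : DerivChain 4 0 x Y :=
    ContDiffOn.derivChain_iteratedDerivWithin hx (by exact_mod_cast hy)
  have hY0 : Y 0 = y := iteratedDerivWithin_zero
  set g : ℕ → ℝ → ℝ := fun i s => (-1) ^ i * Y i (x - s) with hg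
  have hgc : DerivChain 4 0 x g := hYc.comp_const_sub
  set R : ℕ → ℝ → ℝ := fun i s =>
    g i s - ∑ l ∈ Finset.range (4 - i), g (i + l) 0 * s ^ l / (l.factorial : ℝ) with hR
  have hRc : DerivChain 4 0 x R := hgc.sub_taylor
  obtain ⟨M, hM⟩ := isCompact_Icc.exists_bound_of_continuousOn (hRc.cont 4 le_rfl)
  have hM0 : 0 ≤ M := (norm_nonneg _).trans (hM 0 (left_mem_Icc.2 hx.le))
  have hRbd := hRc.abs_le_pow (M := M) (fun i hi => by
    interval_cases i <;> simp [hR, Finset.sum_range_succ]) hM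
  obtain ⟨C, hC⟩ := exists_trapezoid_remainder_le hα hx hM0 hRc hRbd
  have hpow : ∀ j : ℕ, -1 < α - 1 + j := fun j => by
    have : (0 : ℝ) ≤ j := Nat.cast_nonneg j
    linarith
  choose D hD using fun j : ℕ => exists_trapezoid_rpow_le (hpow j) hx
  -- The Taylor coefficients of `s ↦ y (x - s)` at `0`.
  set d : ℕ → ℝ := fun j => g j 0 / (j.factorial : ℝ) with hd
  have hsplit : ∀ s, 0 < s → s ^ (α - 1) * y (x - s)
      = ∑ j ∈ Finset.range 4, d j * s ^ (α - 1 + j) + s ^ (α - 1) * R 0 s := by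
    intro s hs
    have : ∑ j ∈ Finset.range 4, d j * s ^ (α - 1 + j)
        = s ^ (α - 1) * ∑ j ∈ Finset.range 4, g (0 + j) 0 * s ^ j / (j.factorial : ℝ) := by
      rw [Finset.mul_sum]
      refine Finset.sum_congr rfl fun j _ => ?_
      rw [Real.rpow_add_natCast hs.ne', zero_add, hd]
      ring
    rw [this, ← mul_add]
    simp [hR, hg, hY0]
  have hintj : ∀ j : ℕ, IntervalIntegrable (fun s : ℝ => s ^ (α - 1 + j)) volume 0 x :=
    fun j => intervalIntegral.intervalIntegrable_rpow' (hpow j)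
  have hintR : IntervalIntegrable (fun s : ℝ => s ^ (α - 1) * R 0 s) volume 0 x :=
    (intervalIntegral.intervalIntegrable_rpow' (by linarith)).mul_continuousOn (by
      rw [uIcc_of_le hx.le]; exact hRc.cont 0 (by norm_num))
  have hK : fracIntK α y x = ∑ j ∈ Finset.range 4,
      d j * (x ^ (α - 1 + j + 1) / (α - 1 + j + 1)) + ∫ s in (0 : ℝ)..x, s ^ (α - 1) * R 0 s := by
    rw [fracIntK_eq_integral_rpow_mul hx]
    have hcongr : ∫ s in (0 : ℝ)..x, s ^ (α - 1) * y (x - s)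
        = ∫ s in (0 : ℝ)..x, (∑ j ∈ Finset.range 4, d j * s ^ (α - 1 + j)
          + s ^ (α - 1) * R 0 s) := by
      refine intervalIntegral.integral_congr_ae (ae_of_all _ fun s hs => hsplit s ?_)
      rw [uIoc_of_le hx.le] at hs
      exact hs.1
    rw [hcongr, intervalIntegral.integral_add
        (by simpa only [Finset.sum_fn] using
          IntervalIntegrable.sum (Finset.range 4) fun j _ => (hintj j).const_mul (d j)) hintR,
      intervalIntegral.integral_finsetSum fun j _ => (hintj j).const_mul (d j)]
    congr 1
    refine Finset.sum_congr rfl fun j _ => ?_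
    rw [intervalIntegral.integral_const_mul, integral_rpow (Or.inl (hpow j)),
      Real.zero_rpow (by linarith [hpow j]), sub_zero]
  have hend : y 0 / (2 * x ^ (1 - α)) = 1 / 2 * (∑ j ∈ Finset.range 4, d j * x ^ (α - 1 + j)
      + x ^ (α - 1) * R 0 x) := by
    rw [← hsplit x hx, sub_self, show α - 1 = -(1 - α) by ring, Real.rpow_neg hx.le]
    have := (Real.rpow_pos_of_pos hx (1 - α)).ne'
    field_simp
  have hderiv : (α - 1) * x ^ (α - 2) * y 0 - x ^ (α - 1) * Y 1 0
      = ∑ j ∈ Finset.range 4, d j * ((α - 1 + j) * x ^ (α - 1 + j - 1))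
        + ((α - 1) * x ^ (α - 2) * R 0 x + x ^ (α - 1) * R 1 x) := by
    have hg0 : y 0 = g 0 x := by simp [hg, hY0]
    have hg1 : Y 1 0 = -g 1 x := by simp [hg]
    have hxj : ∀ j : ℕ, x ^ (α - 1 + j - 1) = x ^ (α - 2) * x ^ j := fun j => by
      rw [← Real.rpow_add_natCast hx.ne']
      ring_nf
    have hx1 : x ^ (α - 1) = x ^ (α - 2) * x := by
      rw [← Real.rpow_add_one hx.ne']
      ring_nf
    simp only [hxj, hx1, hg0, hg1, hR, hd, Finset.sum_range_succ, Finset.range_zero,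
      Finset.sum_empty, Nat.factorial, Nat.reduceSub, Nat.reduceAdd]
    push_cast
    ring
  refine ⟨∑ j ∈ Finset.range 4, |d j| * D j + C, fun n h hn hxh => ?_⟩
  have hn0 : (0 : ℝ) < n := by exact_mod_cast hn
  have hh : 0 < h := pos_of_mul_pos_right (hxh ▸ hx) hn0.le
  have hsum : h ^ α * ∑ k ∈ Finset.Icc 1 (n - 1), y (x - k * h) / (k : ℝ) ^ (1 - α)
      = ∑ j ∈ Finset.range 4, d j * (h * ∑ k ∈ Finset.Ico 1 n, ((k : ℝ) * h) ^ (α - 1 + j))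
        + h * ∑ k ∈ Finset.Ico 1 n, ((k : ℝ) * h) ^ (α - 1) * R 0 (k * h) := by
    have hIcc : Finset.Icc 1 (n - 1) = Finset.Ico 1 n := by
      ext k
      simp only [Finset.mem_Icc, Finset.mem_Ico]
      omega
    have hterm : ∀ k ∈ Finset.Ico 1 n, h ^ α * (y (x - k * h) / (k : ℝ) ^ (1 - α))
        = h * (∑ j ∈ Finset.range 4, d j * ((k : ℝ) * h) ^ (α - 1 + j)
          + ((k : ℝ) * h) ^ (α - 1) * R 0 (k * h)) := by
      intro k hk
      have hk0 : (0 : ℝ) < k := by exact_mod_cast (Finset.mem_Ico.1 hk).1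
      rw [← hsplit _ (mul_pos hk0 hh), Real.mul_rpow hk0.le hh.le, Real.rpow_sub_one hh.ne',
        show α - 1 = -(1 - α) by ring, Real.rpow_neg hk0.le]
      field_simp
    rw [hIcc, Finset.mul_sum, Finset.sum_congr rfl hterm, ← Finset.mul_sum,
      Finset.sum_add_distrib, mul_add, Finset.sum_comm, Finset.mul_sum]
    congr 1
    refine Finset.sum_congr rfl fun j _ => ?_
    rw [← Finset.mul_sum]
    ring
  have hzeta : zetaReal (1 - α) * y x * h ^ α - zetaReal (-α) * Y 1 x * h ^ (1 + α)
      + zetaReal (-1 - α) * (Y 2 x / 2) * h ^ (2 + α)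
      - zetaReal (-2 - α) * (Y 3 x / 6) * h ^ (3 + α)
      = ∑ j ∈ Finset.range 4, d j * (zetaReal (-(α - 1 + j)) * h ^ (α - 1 + j + 1)) := by
    simp only [hd, hg, Finset.sum_range_succ, Finset.range_zero, Finset.sum_empty, Nat.factorial,
      hY0, sub_zero]
    push_cast
    rw [show -(α - 1 + 0) = 1 - α by ring, show -(α - 1 + 1) = -α by ring,
      show -(α - 1 + 2) = -1 - α by ring, show -(α - 1 + 3) = -2 - α by ring,
      show α - 1 + 0 + 1 = α by ring, show α - 1 + 1 + 1 = 1 + α by ring,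
      show α - 1 + 2 + 1 = 2 + α by ring, show α - 1 + 3 + 1 = 3 + α by ring]
    ring
  set E : ℕ → ℝ := fun j => h * ∑ k ∈ Finset.Ico 1 n, ((k : ℝ) * h) ^ (α - 1 + j)
    + h / 2 * x ^ (α - 1 + j) - x ^ (α - 1 + j + 1) / (α - 1 + j + 1)
    - h ^ 2 / 12 * ((α - 1 + j) * x ^ (α - 1 + j - 1))
    - zetaReal (-(α - 1 + j)) * h ^ (α - 1 + j + 1) with hE
  have hmain : ∑ j ∈ Finset.range 4, |d j * E j| ≤ ∑ j ∈ Finset.range 4, |d j| * D j * h ^ 4 :=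
    Finset.sum_le_sum fun j _ => by
      rw [abs_mul, mul_assoc]
      exact mul_le_mul_of_nonneg_left (hD j n h hn hxh) (abs_nonneg _)
  rw [add_mul, Finset.sum_mul]
  refine le_trans (le_of_eq ?_) ((abs_add_le _ _).trans
    (add_le_add ((Finset.abs_sum_le_sum_abs _ _).trans hmain) (hC n h hn hxh)))
  congr 1
  have hEsum : ∑ j ∈ Finset.range 4, d j * E j
      = ∑ j ∈ Finset.range 4, d j * (h * ∑ k ∈ Finset.Ico 1 n, ((k : ℝ) * h) ^ (α - 1 + j))
        + h / 2 * ∑ j ∈ Finset.range 4, d j * x ^ (α - 1 + j)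
        - ∑ j ∈ Finset.range 4, d j * (x ^ (α - 1 + j + 1) / (α - 1 + j + 1))
        - h ^ 2 / 12 * ∑ j ∈ Finset.range 4, d j * ((α - 1 + j) * x ^ (α - 1 + j - 1))
        - ∑ j ∈ Finset.range 4, d j * (zetaReal (-(α - 1 + j)) * h ^ (α - 1 + j + 1)) := by
    simp only [hE, Finset.mul_sum, ← Finset.sum_add_distrib, ← Finset.sum_sub_distrib]
    refine Finset.sum_congr rfl fun j _ => ?_
    simp only [← Finset.mul_sum]
    ring
  rw [hEsum]
  linear_combination hsum + h * hend - hK - h ^ 2 / 12 * hderiv - hzeta
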